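/- Let $K\subseteq\mathbb{R}^n$ be a closed pointed convex cone with nonempty interior, with dual cone $K^*=\{s : s^Tx\ge 0\ \ \forall x\in K\}$. Let $B:\operatorname{int}K\to\mathbb{R}$ be a $\vartheta$-logarithmically homogeneous self-concordant barrier for $K$, for some $\vartheta\ge 1$; that is, (i) $B$ is convex and three times continuously differentiable on $\operatorname{int}K$, and for all $x\in\operatorname{int}K$ and $u\in\mathbb{R}^n$ the function $\psi(t)=B(x+tu)$ satisfies $|\psi'''(0)|\le 2(\psi''(0))^{3/2}$; (ii) $B(x)\to\infty$ as $x\in\operatorname{int}K$ approaches any boundary point of $K$; (iii) $B(tx)=B(x)-\vartheta\ln t$ for all $x\in\operatorname{int}K$ and $t>0$. For $x\in K$ let $$\nabla^{-2}B(x)=\Big\{M : M=\lim_{k\to\infty}\nabla^2B(x^k)^{-1}\ \text{for some sequence } \{x^k\}\subset\operatorname{int}K \text{ with } x^k\to x\Big\},$$ and for a positive semidefinite matrix $M$ let $M^{1/2}$ be its positive semidefinite square root. For $c=(c_1,\dots,c_m):\mathbb{R}^n\to\mathbb{R}^m$, let $\nabla c(x)$ be the $n\times m$ matrix with columns $\nabla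 c_i(x)$. Theorem. Let $f:\mathbb{R}^n\to\mathbb{R}$ and $c:\mathbb{R}^n\to\mathbb{R}^m$, and let $x^*$ be a local minimizer of $\min\{f(x) : c(x)=0,\ x\in K\}$. Suppose that $f$ and $c$ are twice continuously differentiable at $x^*$ (that is, in a neighborhood of $x^*$ in $\mathbb{R}^n$), and that $M^{1/2}\nabla c(x^*)$ has full column rank for some $M\in\nabla^{-2}B(x^*)$. Then, for every such $M$, there exists $\lambda^*\in\mathbb{R}^m$ such that $$\nabla f(x^*)+\nabla c(x^*)\lambda^*\in K^*,\qquad M^{1/2}\big(\nabla f(x^*)+\nabla c(x^*)\lambda^*\big)=0,$$ and, in addition, with the same $\lambda^*$, $$d^TM^{1/2}\Big(\nabla^2f(x^*)+\sum_{i=1}^m\lambda_i^*\nabla^2c_i(x^*)\Big)M^{1/2}d\ \ge\ 0\qquad\text{for all } d\in\mathbb{R}^n \text{ with } \nabla c(x^*)^TM^{1/2}d=0.$$ -/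

import Mathlib

open Filter Topology

noncomputable section

namespace ConicOpt

/-- `m`-dimensional Euclidean space. -/
abbrev Euc (m : ℕ) : Type := EuclideanSpace ℝ (Fin m)

/-- The Hessian matrix `∇²f(x)` of a real function, as the matrix of the second derivative in the
standard basis. -/
def hess {n : ℕ} (f : Euc n → ℝ) (x : Euc n) : Matrix (Fin n) (Fin n) ℝ :=
  Matrix.of fun i j =>
    fderiv ℝ (fderiv ℝ f) x (EuclideanSpace.single i 1) (EuclideanSpace.single j 1)

/-- The `n × m` matrix `∇c(x)` whose `i`-th column is the gradient of `cᵢ` at `x`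
(the transpose of the Jacobian). -/
def gradMat {n m : ℕ} (c : Euc n → Euc m) (x : Euc n) : Matrix (Fin n) (Fin m) ℝ :=
  Matrix.of fun j i => gradient (fun y => c y i) x j

/-- `B` is a `ϑ`-logarithmically homogeneous self-concordant barrier function for the cone `K`.
Only the values of `B` on the interior of `K` matter. -/
structure IsLHSCBarrier {n : ℕ} (K : Set (Euc n)) (B : Euc n → ℝ) (ϑ : ℝ) : Prop where
  one_le : 1 ≤ ϑ
  convexOn : ConvexOn ℝ (interior K) B
  contDiffOn : ContDiffOn ℝ 3 B (interior K)
  selfConcordant : ∀ x ∈ interior K, ∀ u : Euc n,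
    |iteratedDeriv 3 (fun t : ℝ => B (x + t • u)) 0| ≤
      2 * (iteratedDeriv 2 (fun t : ℝ => B (x + t • u)) 0) ^ (3 / 2 : ℝ)
  barrier : ∀ y ∈ frontier K, Tendsto B (𝓝[interior K] y) atTop
  logHomogeneous : ∀ x ∈ interior K, ∀ t : ℝ, 0 < t → B (t • x) = B x - ϑ * Real.log t

/-- The limiting inverse `∇⁻²B(x)` of the Hessian of `B` at `x`: all limits of `∇²B(xᵏ)⁻¹` along
sequences in the interior of `K` that converge to `x`. -/
def limitingInvHess {n : ℕ} (K : Set (Euc n)) (B : Euc n → ℝ) (x : Euc n) :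
    Set (Matrix (Fin n) (Fin n) ℝ) :=
  {M | ∃ u : ℕ → Euc n, (∀ k, u k ∈ interior K) ∧ Tendsto u atTop (𝓝 x) ∧
    Tendsto (fun k => (hess B (u k))⁻¹) atTop (𝓝 M)}

open scoped MatrixOrder in
/-- The positive semidefinite square root `M^{1/2}` of a positive semidefinite matrix. -/
def psdSqrt {n : ℕ} (M : Matrix (Fin n) (Fin n) ℝ) : Matrix (Fin n) (Fin n) ℝ :=
  CFC.sqrt M

/-- `psdSqrt M` is a positive semidefinite matrix whose square is `M`. -/
theorem psdSqrt_spec {n : ℕ} {M : Matrix (Fin n) (Fin n) ℝ} (hM : M.PosSemidef) :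
    (psdSqrt M).PosSemidef ∧ psdSqrt M * psdSqrt M = M := by
  open scoped MatrixOrder in
  exact ⟨Matrix.nonneg_iff_posSemidef.mp (CFC.sqrt_nonneg M),
    CFC.sqrt_mul_sqrt_self M (Matrix.nonneg_iff_posSemidef.mpr hM)⟩

/-- The feasible set of `min {f(x) : c(x) = 0, x ∈ K}`. -/
def feasible {n m : ℕ} (K : Set (Euc n)) (c : Euc n → Euc m) : Set (Euc n) :=
  {x | c x = 0 ∧ x ∈ K}

/-- The gradient `∇f(x) + ∇c(x) lam` of the Lagrangian. -/
def lagGrad {n m : ℕ} (f : Euc n → ℝ) (c : Euc n → Euc m) (x : Euc n) (lam : Euc m) : Euc n :=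
  gradient f x + WithLp.toLp 2 ((gradMat c x).mulVec lam.ofLp)

/-- The Hessian `∇²f(x) + ∑ᵢ lamᵢ ∇²cᵢ(x)` of the Lagrangian. -/
def lagHess {n m : ℕ} (f : Euc n → ℝ) (c : Euc n → Euc m) (x : Euc n) (lam : Euc m) :
    Matrix (Fin n) (Fin n) ℝ :=
  hess f x + ∑ i, lam i • hess (fun y => c y i) x

end ConicOpt

end

/-!
At a limiting inverse Hessian `M`, the Dikin ellipsoids of the barrier survive in the limit. For
`x` in the interior of `K` with Hessian `H`, self-concordance puts `x + H⁻¹ w` into `K` whenever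
`wᵀ H⁻¹ w < 1` (`IsLHSCBarrier.add_inv_hess_mulVec_mem`), and passing to the limit along the sequence
that defines `M` gives `x* + M w ∈ K` whenever `wᵀ M w < 1`
(`IsLHSCBarrier.add_mulVec_mem_of_mem_limitingInvHess`). Hence all small displacements in the range of
`M`, which is the range of `M^{1/2}`, are compatible with the cone, and since `K` is a convex cone,
any `t • y` with `y ∈ K` and `t ≥ 0` may be added to them.

The rank hypothesis says that the derivative of `c` has a right inverse with values in the range of
`M`. By the implicit function theorem, a line `t ↦ x* + t • v` is turned into a curve in `c = 0` by a
correction in the range of `M` (`exists_curve_mem_level_set`), and this correction does not lead out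
of `K`. Differentiating `f` along such curves, with `v ∈ K` and with `v = ± M e`, gives dual
feasibility and stationarity for one and the same multiplier `lam`. If `v = M e` is tangent to the
constraint, the Lagrangian agrees with `f` on the curve and its first derivative vanishes along the
range of `M`, so its second-order Taylor expansion (`second_fderiv_nonneg_of_curve`) yields the
second-order condition (`exists_multiplier`).
-/

namespace ConicOpt

/-! ### Optimality along curves in a level set -/

section Curves

variable {E F : Type*} [NormedAddCommGroup E] [NormedSpace ℝ E]
  [NormedAddCommGroup F] [NormedSpace ℝ F] [CompleteSpace F]

/-- Near a point where `P` is a right inverse of the derivative of `c`, every line `t ↦ x + t • v`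
can be corrected within the range of `P` so that it stays in the level set of `c`. The correction
`P (z t)` comes from the implicit function theorem for `(t, z) ↦ c (x + t • v + P z)`, whose partial
derivative in `z` is the identity. -/
theorem exists_curve_mem_level_set {c : E → F} {c' : E →L[ℝ] F} {x : E}
    (hc : HasStrictFDerivAt c c' x) {P : F →L[ℝ] E}
    (hP : c' ∘L P = ContinuousLinearMap.id ℝ F) (v : E) :
    ∃ z : ℝ → F, z 0 = 0 ∧ HasDerivAt z (-(c' v)) 0 ∧
      ∀ᶠ t in 𝓝 (0 : ℝ), c (x + (t • v + P (z t))) = c x := by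
  let A : ℝ × F →L[ℝ] E :=
    (ContinuousLinearMap.toSpanSingleton ℝ v).coprod P
  have hA : ∀ p : ℝ × F, A p = p.1 • v + P p.2 := fun p => by simp [A]
  have hG : HasStrictFDerivAt (fun p : ℝ × F => c (x + A p)) (c' ∘L A) (0 : ℝ × F) := by
    have h1 : HasStrictFDerivAt (fun p : ℝ × F => x + A p) A (0 : ℝ × F) :=
      A.hasStrictFDerivAt.const_add x
    refine HasStrictFDerivAt.comp (0 : ℝ × F) ?_ h1
    simpa using hc
  have hinr : (c' ∘L A) ∘L ContinuousLinearMap.inr ℝ ℝ F = ContinuousLinearMap.id ℝ F := by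
    ext z
    simpa [hA] using congrArg (fun T : F →L[ℝ] F => T z) hP
  have hinv : ((c' ∘L A) ∘L ContinuousLinearMap.inr ℝ ℝ F).IsInvertible := by
    rw [hinr]; exact ContinuousLinearMap.isInvertible_equiv (f := ContinuousLinearEquiv.refl ℝ F)
  have hd := (hG.hasStrictFDerivAt_implicitFunctionOfProdDomain hinv).hasFDerivAt.hasDerivAt
  have h0 : hG.implicitFunctionOfProdDomain hinv 0 = 0 := by
    have h := (hG.eventually_apply_eq_iff_implicitFunctionOfProdDomain hinv).self_of_nhds
    simpa using h
  refine ⟨hG.implicitFunctionOfProdDomain hinv, h0, ?_, ?_⟩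
  · convert! hd using 1
    simp [hinr, hA]
  · filter_upwards [hG.eventually_apply_implicitFunctionOfProdDomain hinv] with t ht
    simpa [hA] using ht

/-- If `S` contains the points `x + t • v + P z` with small `t ≥ 0` and small `z`, the corrected curve
is feasible for `t > 0`, so that `f` does not fall below `f x` along it. -/
theorem exists_feasible_curve {S : Set E} {f : E → ℝ} {c : E → F}
    {c' : E →L[ℝ] F} {x : E} (hcx : c x = 0) (hc : HasStrictFDerivAt c c' x)
    (hmin : IsLocalMinOn f {y | c y = 0 ∧ y ∈ S} x) {P : F →L[ℝ] E}
    (hP : c' ∘L P = ContinuousLinearMap.id ℝ F) {v : E}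
    (hv : ∀ᶠ p : ℝ × F in 𝓝 0, 0 ≤ p.1 → x + (p.1 • v + P p.2) ∈ S) :
    ∃ z : ℝ → F, z 0 = 0 ∧ HasDerivAt z (-(c' v)) 0 ∧
      ∀ᶠ t in 𝓝[>] (0 : ℝ), c (x + (t • v + P (z t))) = 0 ∧ f x ≤ f (x + (t • v + P (z t))) := by
  obtain ⟨z, hz0, hz, hcz⟩ := exists_curve_mem_level_set hc hP v
  refine ⟨z, hz0, hz, ?_⟩
  have hzc : Tendsto (fun t : ℝ => (t, z t)) (𝓝 0) (𝓝 0) := by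
    have : ContinuousAt (fun t : ℝ => (t, z t)) 0 := continuousAt_id.prodMk hz.continuousAt
    simpa [ContinuousAt, hz0] using! this
  have hcurve : Tendsto (fun t : ℝ => x + (t • v + P (z t))) (𝓝 0) (𝓝 x) := by
    have : ContinuousAt (fun t : ℝ => x + (t • v + P (z t))) 0 :=
      continuousAt_const.add ((continuousAt_id.smul continuousAt_const).add
        (P.continuous.continuousAt.comp hz.continuousAt))
    simpa [ContinuousAt, hz0] using this
  have hmin' := eventually_nhdsWithin_iff.1 hmin
  filter_upwards [nhdsWithin_le_nhds hcz, nhdsWithin_le_nhds (hzc.eventually hv),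
    nhdsWithin_le_nhds (hcurve.eventually hmin'), self_mem_nhdsWithin] with t h1 h2 h3 h4
  have h1' : c (x + (t • v + P (z t))) = 0 := h1.trans hcx
  exact ⟨h1', h3 ⟨h1', h2 (le_of_lt h4)⟩⟩

/-- The right derivative at `0` of `f` along the feasible curve with initial velocity
`v - P (c' v)` is nonnegative. -/
theorem nonneg_of_feasible_direction {S : Set E} {f : E → ℝ} {f' : E →L[ℝ] ℝ} {c : E → F}
    {c' : E →L[ℝ] F} {x : E} (hcx : c x = 0) (hf : HasFDerivAt f f' x)
    (hc : HasStrictFDerivAt c c' x)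
    (hmin : IsLocalMinOn f {y | c y = 0 ∧ y ∈ S} x) {P : F →L[ℝ] E}
    (hP : c' ∘L P = ContinuousLinearMap.id ℝ F) {v : E}
    (hv : ∀ᶠ p : ℝ × F in 𝓝 0, 0 ≤ p.1 → x + (p.1 • v + P p.2) ∈ S) :
    0 ≤ f' v - f' (P (c' v)) := by
  obtain ⟨z, hz0, hz, hfz⟩ := exists_feasible_curve hcx hc hmin hP hv
  have hg : HasDerivAt (fun t : ℝ => f (x + (t • v + P (z t)))) (f' v - f' (P (c' v))) 0 := by
    have h1 : HasDerivAt (fun t : ℝ => x + (t • v + P (z t))) ((1 : ℝ) • v + P (-(c' v))) 0 :=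
      (((hasDerivAt_id (0 : ℝ)).smul_const v).add (P.hasFDerivAt.comp_hasDerivAt 0 hz)).const_add x
    have h2 : HasFDerivAt f f' (x + ((0 : ℝ) • v + P (z 0))) := by simpa [hz0] using hf
    convert! h2.comp_hasDerivAt 0 h1 using 1
    simp [sub_eq_add_neg]
  have hs := (hasDerivAt_iff_tendsto_slope_zero.1 hg).mono_left (nhdsGT_le_nhdsNE 0)
  refine ge_of_tendsto hs ?_
  filter_upwards [hfz, self_mem_nhdsWithin] with t ht htpos
  have htpos' : 0 < t := htpos
  have := ht.2
  simp only [zero_add, hz0, zero_smul, map_zero, add_zero, smul_eq_mul]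
  exact mul_nonneg (inv_nonneg.2 htpos'.le) (by linarith)

end Curves

section SecondOrder

variable {E : Type*} [NormedAddCommGroup E] [NormedSpace ℝ E]

/-- Taylor expansion of order two with a Peano remainder: the remainder has derivative
`DL (x + h) - DL x - D²L x h = o(‖h‖)`, by the symmetry of `D²L x`. -/
theorem taylor_two_isLittleO {L : E → ℝ} {x : E} (hL : ContDiffAt ℝ 2 L x) :
    (fun h => L (x + h) - L x - fderiv ℝ L x h - (1 / 2 : ℝ) * fderiv ℝ (fderiv ℝ L) x h h)
      =o[𝓝 0] fun h => ‖h‖ ^ 2 := by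
  set L₂ := fderiv ℝ (fderiv ℝ L) x with hL₂
  have hd2 : HasFDerivAt (fderiv ℝ L) L₂ x :=
    ((hL.fderiv_right (m := 1) (by norm_num)).differentiableAt (by norm_num)).hasFDerivAt
  have hsymm : ∀ a b, L₂ a b = L₂ b a := fun a b =>
    (hL.isSymmSndFDerivAt (by simp)) a b
  have hev : ∀ᶠ h in 𝓝 (0 : E), DifferentiableAt ℝ L (x + h) := by
    have h1 : ∀ᶠ y in 𝓝 x, DifferentiableAt ℝ L y := by
      filter_upwards [hL.eventually (by simp)] with y hy
      exact hy.differentiableAt (by norm_num)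
    have h2 : Tendsto (fun h : E => x + h) (𝓝 0) (𝓝 x) := by
      simpa using (continuous_const.add continuous_id).tendsto' (f := fun h : E => x + h) 0 x
        (by simp)
    exact h2.eventually h1
  obtain ⟨ε, hε, hball⟩ := Metric.eventually_nhds_iff_ball.1 hev
  set g : E → ℝ := fun h => L (x + h) - L x - fderiv ℝ L x h - (1 / 2 : ℝ) * L₂ h h with hg
  have hgd : ∀ h ∈ Metric.ball (0 : E) ε,
      HasFDerivWithinAt g (fderiv ℝ L (x + h) - fderiv ℝ L x - L₂ h) (Metric.ball 0 ε) h := by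
    intro h hh
    have h1 : HasFDerivAt (fun h => L (x + h)) (fderiv ℝ L (x + h)) h :=
      (hasFDerivAt_comp_add_left x).2 (hball h hh).hasFDerivAt
    have h2 : HasFDerivAt (fun h => L₂ h h) (L₂ h + L₂.flip h) h := by
      convert! (L₂.hasFDerivAt (x := h)).clm_apply (hasFDerivAt_id h) using 1
    have h3 := ((h1.sub_const (L x)).sub (fderiv ℝ L x).hasFDerivAt).sub (h2.const_mul (1 / 2 : ℝ))
    refine HasFDerivAt.hasFDerivWithinAt ?_
    convert! h3 using 1
    ext k
    simp [hsymm k h]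
    ring
  have hlit : (fun h => fderiv ℝ L (x + h) - fderiv ℝ L x - L₂ h)
      =o[𝓝[Metric.ball 0 ε] 0] fun h => ‖h - 0‖ ^ 1 := by
    have := (hasFDerivAt_iff_isLittleO_nhds_zero.1 hd2).norm_right
    simpa using this.mono nhdsWithin_le_nhds
  have := (convex_ball (0 : E) ε).isLittleO_pow_succ (Metric.mem_ball_self hε) hgd hlit
  rw [Metric.isOpen_ball.nhdsWithin_eq (Metric.mem_ball_self hε)] at this
  simpa [hg] using this

/-- Only the velocity of the curve enters, since `DL x` vanishes on the whole curve `h` and the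
second derivative of `h` (which need not exist) plays no part. -/
theorem second_fderiv_nonneg_of_curve {L : E → ℝ} {x v : E} (hL : ContDiffAt ℝ 2 L x)
    {h : ℝ → E} (h0 : h 0 = 0) (hh : HasDerivAt h v 0)
    (hcrit : ∀ t, fderiv ℝ L x (h t) = 0) (hle : ∀ᶠ t in 𝓝[>] (0 : ℝ), L x ≤ L (x + h t)) :
    0 ≤ fderiv ℝ (fderiv ℝ L) x v v := by
  set L₂ := fderiv ℝ (fderiv ℝ L) x with hL₂
  have hh0 : Tendsto h (𝓝 0) (𝓝 0) := by simpa [ContinuousAt, h0] using hh.continuousAt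
  have hO : h =O[𝓝 0] fun t : ℝ => t := by simpa [h0] using hh.isBigO_sub
  have hlit := ((taylor_two_isLittleO hL).comp_tendsto hh0).trans_isBigO
    ((hO.norm_left.pow 2) : _ =O[𝓝 0] fun t : ℝ => t ^ 2)
  have hrem := (hlit.mono (nhdsWithin_le_nhds (s := Set.Ioi (0 : ℝ)))).tendsto_div_nhds_zero
  have hs : Tendsto (fun t : ℝ => t⁻¹ • h t) (𝓝[>] 0) (𝓝 v) := by
    simpa [h0] using (hasDerivAt_iff_tendsto_slope_zero.1 hh).mono_left (nhdsGT_le_nhdsNE 0)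
  have hq : Tendsto (fun t : ℝ => (1 / 2 : ℝ) * L₂ (t⁻¹ • h t) (t⁻¹ • h t)) (𝓝[>] 0)
      (𝓝 ((1 / 2 : ℝ) * L₂ v v)) :=
    ((by fun_prop : Continuous fun w : E => (1 / 2 : ℝ) * L₂ w w).tendsto v).comp hs
  have hlim := hrem.add hq
  rw [zero_add] at hlim
  have : 0 ≤ (1 / 2 : ℝ) * L₂ v v := by
    refine ge_of_tendsto hlim ?_
    filter_upwards [hle, self_mem_nhdsWithin] with t ht htpos
    have htpos' : (0 : ℝ) < t := htpos
    have hc := hcrit t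
    have : (L (x + h t) - L x) / t ^ 2 =
        (L (x + h t) - L x - fderiv ℝ L x (h t) - (1 / 2 : ℝ) * L₂ (h t) (h t)) / t ^ 2 +
          (1 / 2 : ℝ) * L₂ (t⁻¹ • h t) (t⁻¹ • h t) := by
      rw [hc]
      simp only [map_smul, smul_eq_mul, smul_apply]
      field_simp
      ring
    simp only [Function.comp]
    rw [← this]
    exact div_nonneg (by linarith) (by positivity)
  linarith

end SecondOrder

/-! ### The Dikin ellipsoid of a self-concordant barrier -/

section Dikin

/-- The inequality `|φ'| ≤ 2 φ ^ (3 / 2)` makes `(φ + δ) ^ (-1 / 2) + t` nondecreasing, which keeps `φ`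
bounded on an interval of length at most `1` when `φ 0 < 1`. The shift by `δ > 0` allows `φ` to
vanish. -/
theorem second_deriv_le_of_selfConcordant {φ φ' : ℝ → ℝ} {T δ : ℝ} (hT : T ≤ 1) (hδ : 0 < δ)
    (hφ : ∀ t ∈ Set.Ico 0 T, HasDerivAt φ (φ' t) t) (hpos : ∀ t ∈ Set.Ico 0 T, 0 ≤ φ t)
    (hsc : ∀ t ∈ Set.Ico 0 T, |φ' t| ≤ 2 * φ t ^ (3 / 2 : ℝ)) (h0 : φ 0 + δ < 1) :
    ∃ C, ∀ t ∈ Set.Ico 0 T, φ t ≤ C := by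
  by_cases hT0 : T ≤ 0
  · exact ⟨0, fun t ht => absurd (ht.1.trans_lt ht.2) (not_lt.2 hT0)⟩
  push Not at hT0
  have h0m : (0 : ℝ) ∈ Set.Ico 0 T := ⟨le_rfl, hT0⟩
  set a : ℝ := (φ 0 + δ) ^ (-(1 / 2) : ℝ) with ha
  have ha1 : 1 < a :=
    Real.one_lt_rpow_of_pos_of_lt_one_of_neg (by linarith [hpos 0 h0m]) h0 (by norm_num)
  refine ⟨(a - 1) ^ (-2 : ℝ), fun t ht => ?_⟩
  have hder : ∀ s ∈ Set.Ico 0 T, HasDerivAt (fun s => (φ s + δ) ^ (-(1 / 2) : ℝ) + s)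
      (φ' s * (-(1 / 2)) * (φ s + δ) ^ (-(1 / 2) - 1 : ℝ) + 1) s := fun s hs =>
    (((hφ s hs).add_const δ).rpow_const
      (Or.inl (by linarith [hpos s hs] : (φ s + δ) ≠ 0))).add (hasDerivAt_id s)
  have hmono : MonotoneOn (fun s => (φ s + δ) ^ (-(1 / 2) : ℝ) + s) (Set.Ico 0 T) := by
    refine monotoneOn_of_deriv_nonneg (convex_Ico 0 T)
      (fun s hs => (hder s hs).continuousAt.continuousWithinAt)
      (fun s hs => (hder s (interior_subset hs)).differentiableAt.differentiableWithinAt)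
      fun s hs => ?_
    have hs' := interior_subset hs
    rw [(hder s hs').deriv]
    have hp : 0 < φ s + δ := by linarith [hpos s hs']
    have h1 : φ' s ≤ 2 * (φ s + δ) ^ (3 / 2 : ℝ) :=
      (le_abs_self _).trans ((hsc s hs').trans (by
        have := hpos s hs'
        gcongr
        linarith))
    have h2 : (φ s + δ) ^ (3 / 2 : ℝ) * (φ s + δ) ^ (-(1 / 2) - 1 : ℝ) = 1 := by
      rw [← Real.rpow_add hp]; norm_num
    have h3 : φ' s * (φ s + δ) ^ (-(1 / 2) - 1 : ℝ) ≤
        2 * (φ s + δ) ^ (3 / 2 : ℝ) * (φ s + δ) ^ (-(1 / 2) - 1 : ℝ) :=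
      mul_le_mul_of_nonneg_right h1 (Real.rpow_nonneg hp.le _)
    linarith
  have h := hmono h0m ht ht.1
  simp only [add_zero] at h
  have hp : 0 < φ t + δ := by linarith [hpos t ht]
  have h4 : a - 1 ≤ (φ t + δ) ^ (-(1 / 2) : ℝ) := by linarith [ht.2]
  have h5 := Real.rpow_le_rpow_of_nonpos (by linarith) h4 (by norm_num : (-2 : ℝ) ≤ 0)
  rw [← Real.rpow_mul hp.le] at h5
  norm_num at h5
  norm_num
  linarith

theorem bddAbove_of_second_deriv_le {ψ ψ' ψ'' : ℝ → ℝ} {T C : ℝ}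
    (h1 : ∀ t ∈ Set.Ico 0 T, HasDerivAt ψ (ψ' t) t)
    (h2 : ∀ t ∈ Set.Ico 0 T, HasDerivAt ψ' (ψ'' t) t)
    (hC : ∀ t ∈ Set.Ico 0 T, ψ'' t ≤ C) :
    ∃ D, ∀ t ∈ Set.Ico 0 T, ψ t ≤ D := by
  have anti : ∀ {g g' : ℝ → ℝ}, (∀ t ∈ Set.Ico 0 T, HasDerivAt g (g' t) t) →
      (∀ t ∈ Set.Ico 0 T, g' t ≤ 0) → AntitoneOn g (Set.Ico 0 T) := fun hg hg' =>
    antitoneOn_of_deriv_nonpos (convex_Ico 0 T)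
      (fun s hs => (hg s hs).continuousAt.continuousWithinAt)
      (fun s hs => (hg s (interior_subset hs)).differentiableAt.differentiableWithinAt)
      fun s hs => by
        rw [(hg s (interior_subset hs)).deriv]
        exact hg' s (interior_subset hs)
  by_cases hT0 : T ≤ 0
  · exact ⟨0, fun t ht => absurd (ht.1.trans_lt ht.2) (not_lt.2 hT0)⟩
  push Not at hT0
  have h0m : (0 : ℝ) ∈ Set.Ico 0 T := ⟨le_rfl, hT0⟩
  have hA : AntitoneOn (fun t => ψ' t - C * t) (Set.Ico 0 T) :=
    anti (fun t ht => (h2 t ht).sub ((hasDerivAt_id t).const_mul C))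
      (fun t ht => by linarith [hC t ht])
  have hψ' : ∀ t ∈ Set.Ico 0 T, ψ' t ≤ |ψ' 0| + |C| * T := fun t ht => by
    have := hA h0m ht ht.1
    have h3 : C * t ≤ |C| * T := mul_le_mul (le_abs_self C) ht.2.le ht.1 (abs_nonneg C)
    have h4 := le_abs_self (ψ' 0)
    simp only [mul_zero, sub_zero] at this
    linarith
  set D := |ψ' 0| + |C| * T with hD
  have hD0 : 0 ≤ D := by positivity
  have hA' : AntitoneOn (fun t => ψ t - D * t) (Set.Ico 0 T) :=
    anti (fun t ht => (h1 t ht).sub ((hasDerivAt_id t).const_mul D))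
      (fun t ht => by linarith [hψ' t ht])
  refine ⟨ψ 0 + D * T, fun t ht => ?_⟩
  have := hA' h0m ht ht.1
  have h3 : D * t ≤ D * T := mul_le_mul_of_nonneg_left ht.2.le hD0
  simp only [mul_zero, sub_zero] at this
  linarith

/-- A segment that starts in an open set `U` and ends outside `U` leaves `U` for the first time at a
point of its boundary. -/
theorem exists_frontier_of_segment {E : Type*} [NormedAddCommGroup E] [NormedSpace ℝ E]
    {U : Set E} (hU : IsOpen U) {x u : E} (hx : x ∈ U) (hxu : x + u ∉ U) :
    ∃ T : ℝ, 0 < T ∧ T ≤ 1 ∧ (∀ t ∈ Set.Ico 0 T, x + t • u ∈ U) ∧ x + T • u ∈ closure U ∧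
      x + T • u ∉ U := by
  let γ : ℝ → E := fun t => x + t • u
  have hγ : Continuous γ := by fun_prop
  let Z : Set ℝ := Set.Icc 0 1 ∩ γ ⁻¹' Uᶜ
  have hZc : IsCompact Z := isCompact_Icc.inter_right (hU.isClosed_compl.preimage hγ)
  have hZne : Z.Nonempty := ⟨1, ⟨by norm_num, by simpa [γ] using hxu⟩⟩
  obtain ⟨T, hTZ, hTmin⟩ := hZc.exists_isLeast hZne
  have hT0 : 0 < T := lt_of_le_of_ne hTZ.1.1 (by
    rintro rfl
    exact hTZ.2 (by simpa [γ] using hx))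
  have hin : ∀ t ∈ Set.Ico 0 T, x + t • u ∈ U := fun t ht => by
    by_contra hcon
    exact absurd (hTmin ⟨⟨ht.1, ht.2.le.trans hTZ.1.2⟩, hcon⟩) (not_le.2 ht.2)
  refine ⟨T, hT0, hTZ.1.2, hin, ?_, hTZ.2⟩
  refine closure_mono (s := γ '' Set.Ico 0 T) (by rintro _ ⟨t, ht, rfl⟩; exact hin t ht) ?_
  refine image_closure_subset_closure_image hγ ⟨T, ?_, rfl⟩
  rw [closure_Ico hT0.ne]
  exact ⟨hT0.le, le_rfl⟩

variable {n : ℕ} {K : Set (Euc n)} {B : Euc n → ℝ} {ϑ : ℝ}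

theorem IsLHSCBarrier.contDiffAt_line (hB : IsLHSCBarrier K B ϑ) {x u : Euc n} {t : ℝ}
    (hx : x + t • u ∈ interior K) : ContDiffAt ℝ 3 (fun s : ℝ => B (x + s • u)) t := by
  have h1 : ContDiffAt ℝ 3 B (x + t • u) :=
    hB.contDiffOn.contDiffAt (isOpen_interior.mem_nhds hx)
  exact h1.comp t (f := fun s : ℝ => x + s • u) (by fun_prop)

theorem hasDerivAt_iteratedDeriv_of_contDiffAt {ψ : ℝ → ℝ} {t : ℝ} (h : ContDiffAt ℝ 3 ψ t)
    {k : ℕ} (hk : k < 3) :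
    HasDerivAt (iteratedDeriv k ψ) (iteratedDeriv (k + 1) ψ t) t := by
  rw [iteratedDeriv_succ]
  rw [iteratedDeriv_eq_equiv_comp]
  exact ((LinearIsometryEquiv.differentiable _ _).comp t
    (h.differentiableAt_iteratedFDeriv (by exact_mod_cast hk))).hasDerivAt

theorem iteratedDeriv_line_shift (B : Euc n → ℝ) (x u : Euc n) (k : ℕ) (t : ℝ) :
    iteratedDeriv k (fun s : ℝ => B ((x + t • u) + s • u)) 0 =
      iteratedDeriv k (fun s : ℝ => B (x + s • u)) t := by
  have := congrFun (iteratedDeriv_comp_const_add k (fun s : ℝ => B (x + s • u)) t) 0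
  simpa [add_smul, add_assoc] using this

theorem IsLHSCBarrier.second_deriv_line_nonneg (hB : IsLHSCBarrier K B ϑ) {x : Euc n}
    (hx : x ∈ interior K) (u : Euc n) :
    0 ≤ iteratedDeriv 2 (fun t : ℝ => B (x + t • u)) 0 := by
  set ψ : ℝ → ℝ := fun t => B (x + t • u) with hψ
  let γ : ℝ →ᵃ[ℝ] Euc n := AffineMap.lineMap x (x + u)
  have hγ : ∀ t, γ t = x + t • u := fun t => by simp [γ, AffineMap.lineMap_apply, add_comm]
  have hconv : ConvexOn ℝ (γ ⁻¹' interior K) ψ := by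
    have := hB.convexOn.comp_affineMap γ
    convert! this using 1
    ext t; simp [hψ, hγ]
  have hopen : IsOpen (γ ⁻¹' interior K) := isOpen_interior.preimage (by
    have : (γ : ℝ → Euc n) = fun t => x + t • u := funext hγ
    rw [this]; fun_prop)
  have hd : ∀ t ∈ γ ⁻¹' interior K, ContDiffAt ℝ 3 ψ t := fun t ht =>
    hB.contDiffAt_line (by simpa [hγ] using ht)
  have hmono := hconv.monotoneOn_deriv fun t ht => (hd t ht).differentiableAt (by norm_num)
  have h0 : (0 : ℝ) ∈ γ ⁻¹' interior K := by simpa [hγ] using hx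
  have hder := hasDerivAt_iteratedDeriv_of_contDiffAt (hd 0 h0) (k := 1) (by norm_num)
  rw [iteratedDeriv_one] at hder
  have hw := hder.hasDerivWithinAt (s := γ ⁻¹' interior K)
  have := hmono.derivWithin_nonneg (x := 0)
  rwa [hw.derivWithin (hopen.uniqueDiffWithinAt h0)] at this

/-- The open Dikin ellipsoid around `x`, the unit ball of the Hessian norm of `B` at `x`, lies in the
interior of `K`: up to a first exit point the second derivative of `B` along the segment would be
bounded, hence so would `B` be, although `B` tends to infinity at the boundary. -/
theorem IsLHSCBarrier.add_mem_interior (hB : IsLHSCBarrier K B ϑ) {x u : Euc n}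
    (hx : x ∈ interior K) (hu : iteratedDeriv 2 (fun t : ℝ => B (x + t • u)) 0 < 1) :
    x + u ∈ interior K := by
  by_contra hcon
  obtain ⟨T, hT0, hT1, hin, hcl, hnot⟩ := exists_frontier_of_segment isOpen_interior hx hcon
  set ψ : ℝ → ℝ := fun t => B (x + t • u) with hψ
  have hd : ∀ t ∈ Set.Ico 0 T, ContDiffAt ℝ 3 ψ t := fun t ht => hB.contDiffAt_line (hin t ht)
  obtain ⟨C, hC⟩ := second_deriv_le_of_selfConcordant hT1
    (δ := (1 - iteratedDeriv 2 ψ 0) / 2) (by linarith)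
    (fun t ht => hasDerivAt_iteratedDeriv_of_contDiffAt (hd t ht) (k := 2) (by norm_num))
    (fun t ht => by
      have := hB.second_deriv_line_nonneg (hin t ht) u
      rwa [iteratedDeriv_line_shift] at this)
    (fun t ht => by
      have := hB.selfConcordant _ (hin t ht) u
      rwa [iteratedDeriv_line_shift, iteratedDeriv_line_shift] at this)
    (by linarith)
  obtain ⟨D, hD⟩ := bddAbove_of_second_deriv_le
    (fun t ht => hasDerivAt_iteratedDeriv_of_contDiffAt (hd t ht) (k := 0) (by norm_num))
    (fun t ht => hasDerivAt_iteratedDeriv_of_contDiffAt (hd t ht) (k := 1) (by norm_num)) hC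
  have hfr : x + T • u ∈ frontier K := ⟨closure_mono interior_subset hcl, hnot⟩
  have hlim : Tendsto (fun t : ℝ => x + t • u) (𝓝[<] T) (𝓝[interior K] (x + T • u)) := by
    refine tendsto_nhdsWithin_iff.2 ⟨?_, ?_⟩
    · exact ((by fun_prop : Continuous fun t : ℝ => x + t • u).tendsto T).mono_left
        nhdsWithin_le_nhds
    · filter_upwards [Ico_mem_nhdsLT hT0] with t ht using hin t ht
  have hbig := ((hB.barrier _ hfr).comp hlim).eventually_gt_atTop D
  obtain ⟨t, ht1, ht2⟩ := (hbig.and (Ico_mem_nhdsLT hT0)).exists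
  exact absurd (hD t ht2) (not_le.2 (by simpa [iteratedDeriv_zero, hψ] using ht1))

end Dikin

open Matrix WithLp

/-! ### Hessian and gradient matrices -/

section Hessian

variable {n m : ℕ}

theorem dotProduct_hess_mulVec (f : Euc n → ℝ) (x : Euc n) (d e : Fin n → ℝ) :
    d ⬝ᵥ hess f x *ᵥ e = fderiv ℝ (fderiv ℝ f) x (toLp 2 d) (toLp 2 e) := by
  have hsum : ∀ w : Fin n → ℝ, toLp 2 w = ∑ i, w i • (EuclideanSpace.single i (1 : ℝ)) := fun w => by
    simpa using ((EuclideanSpace.basisFun (Fin n) ℝ).sum_repr (toLp 2 w)).symm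
  rw [hsum d, hsum e]
  simp only [map_sum, map_smul, _root_.sum_apply, _root_.smul_apply, smul_eq_mul, dotProduct,
    mulVec, hess, Matrix.of_apply, Finset.mul_sum]
  rw [Finset.sum_comm]
  refine Finset.sum_congr rfl fun i _ => Finset.sum_congr rfl fun j _ => by
    ring

theorem hess_eq_iteratedFDeriv (f : Euc n → ℝ) (x : Euc n) :
    hess f x = Matrix.of fun i j => iteratedFDeriv ℝ 2 f x
      ![EuclideanSpace.single i 1, EuclideanSpace.single j 1] := by
  ext i j
  simp [hess, iteratedFDeriv_two_apply]

theorem hess_isHermitian {f : Euc n → ℝ} {x : Euc n} (hf : ContDiffAt ℝ 2 f x) :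
    (hess f x).IsHermitian := by
  ext i j
  simpa [hess] using (hf.isSymmSndFDerivAt (by simp)) _ _

theorem hess_lagrangian {f : Euc n → ℝ} {c : Euc n → Euc m} {x : Euc n} (lam : Euc m)
    (hf : ContDiffAt ℝ 2 f x) (hc : ContDiffAt ℝ 2 c x) :
    hess (fun y => f y + inner ℝ lam (c y)) x = lagHess f c x lam := by
  have hci : ∀ i, ContDiffAt ℝ 2 (fun y => c y i) x := fun i => (contDiffAt_piLp 2).1 hc i
  have hL : (fun y => f y + inner ℝ lam (c y)) = fun y => f y + ∑ i, lam i • c y i := by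
    ext y; simp [PiLp.inner_apply, mul_comm]
  rw [hL, lagHess]
  simp only [hess_eq_iteratedFDeriv]
  rw [fun_iteratedFDeriv_add_apply (i := 2) hf
      (ContDiffAt.sum fun i _ => (hci i).const_smul (lam i)),
    iteratedFDeriv_fun_sum_apply (n := 2) fun i _ => (hci i).const_smul (lam i)]
  ext j k
  simp only [Matrix.of_apply, Matrix.add_apply, Matrix.sum_apply, Matrix.smul_apply,
    _root_.add_apply, _root_.sum_apply]
  congr 1
  refine Finset.sum_congr rfl fun i _ => ?_
  rw [iteratedFDeriv_const_smul_apply' (i := 2) (hci i)]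
  rfl

theorem gradMat_transpose_mulVec {c : Euc n → Euc m} {x : Euc n} (hc : DifferentiableAt ℝ c x)
    (v : Euc n) : (gradMat c x)ᵀ *ᵥ v.ofLp = (fderiv ℝ c x v).ofLp := by
  ext i
  have h1 : HasFDerivAt (fun y => c y i) ((EuclideanSpace.proj i : Euc m →L[ℝ] ℝ) ∘L fderiv ℝ c x)
      x := (EuclideanSpace.proj i : Euc m →L[ℝ] ℝ).hasFDerivAt.comp x hc.hasFDerivAt
  have h2 : inner ℝ (gradient (fun y => c y i) x) v = fderiv ℝ c x v i := by
    rw [inner_gradient_left, h1.fderiv]; rfl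
  rw [← h2, PiLp.inner_apply]
  simp [mulVec, dotProduct, gradMat, mul_comm]

theorem inner_lagGrad {f : Euc n → ℝ} {c : Euc n → Euc m} {x : Euc n} (lam : Euc m)
    (hc : DifferentiableAt ℝ c x) (v : Euc n) :
    inner ℝ (lagGrad f c x lam) v = fderiv ℝ f x v + inner ℝ lam (fderiv ℝ c x v) := by
  rw [lagGrad, inner_add_left, inner_gradient_left]
  congr 1
  simp only [EuclideanSpace.inner_eq_star_dotProduct, star_trivial, ← gradMat_transpose_mulVec hc]
  rw [mulVec_transpose, ← dotProduct_mulVec]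

end Hessian

/-! ### The limiting Dikin ellipsoid -/

section Barrier

variable {n : ℕ} {K : Set (Euc n)} {B : Euc n → ℝ} {ϑ : ℝ}

theorem iteratedDeriv_two_line {f : Euc n → ℝ} {x : Euc n} (hf : ContDiffAt ℝ 2 f x)
    (u : Euc n) :
    iteratedDeriv 2 (fun t : ℝ => f (x + t • u)) 0 = u.ofLp ⬝ᵥ hess f x *ᵥ u.ofLp := by
  rw [dotProduct_hess_mulVec]
  have hl : ∀ t : ℝ, HasDerivAt (fun t : ℝ => x + t • u) u t := fun t => by
    simpa using ((hasDerivAt_id t).smul_const u).const_add x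
  have hlim : Tendsto (fun t : ℝ => x + t • u) (𝓝 0) (𝓝 x) := by
    simpa using (hl 0).continuousAt.tendsto
  have h1 : deriv (fun t : ℝ => f (x + t • u)) =ᶠ[𝓝 0] fun t => fderiv ℝ f (x + t • u) u := by
    filter_upwards [hlim.eventually (hf.eventually (by simp))] with t ht
    exact ((ht.differentiableAt (by norm_num)).hasFDerivAt.comp_hasDerivAt t (hl t)).deriv
  have h2 : HasFDerivAt (fderiv ℝ f) (fderiv ℝ (fderiv ℝ f) x) (x + (0 : ℝ) • u) := by
    simpa using ((hf.fderiv_right (m := 1) (by norm_num)).differentiableAt (by norm_num)).hasFDerivAt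
  have h3 : HasDerivAt (fun t : ℝ => fderiv ℝ f (x + t • u) u)
      (fderiv ℝ (fderiv ℝ f) x u u) 0 := by
    have h4 : HasDerivAt (fun t : ℝ => fderiv ℝ f (x + t • u)) (fderiv ℝ (fderiv ℝ f) x u) 0 :=
      h2.comp_hasDerivAt 0 (hl 0)
    exact (ContinuousLinearMap.apply ℝ ℝ u).hasFDerivAt.comp_hasDerivAt 0 h4
  rw [iteratedDeriv_succ, iteratedDeriv_one, h1.deriv_eq]
  exact h3.deriv

theorem IsLHSCBarrier.contDiffAt_two (hB : IsLHSCBarrier K B ϑ) {x : Euc n}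
    (hx : x ∈ interior K) : ContDiffAt ℝ 2 B x :=
  (hB.contDiffOn.contDiffAt (isOpen_interior.mem_nhds hx)).of_le (by norm_num)

theorem IsLHSCBarrier.hess_posSemidef (hB : IsLHSCBarrier K B ϑ) {x : Euc n}
    (hx : x ∈ interior K) : (hess B x).PosSemidef := by
  have h2 := hB.contDiffAt_two hx
  refine .of_dotProduct_mulVec_nonneg (hess_isHermitian h2) fun d => ?_
  have := hB.second_deriv_line_nonneg hx (toLp 2 d)
  rw [iteratedDeriv_two_line h2] at this
  simpa using this

/-- The Dikin ellipsoid in the dual parametrization `u = H⁻¹ w`, for which `uᵀ H u = wᵀ H⁻¹ w`. If the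
Hessian `H` is singular, the matrix `H⁻¹` is `0` by convention and the claim is trivial, so
that nondegeneracy of the barrier is not needed. -/
theorem IsLHSCBarrier.add_inv_hess_mulVec_mem (hB : IsLHSCBarrier K B ϑ) {x : Euc n}
    (hx : x ∈ interior K) {w : Fin n → ℝ} (hw : w ⬝ᵥ (hess B x)⁻¹ *ᵥ w < 1) :
    x + toLp 2 ((hess B x)⁻¹ *ᵥ w) ∈ interior K := by
  by_cases hdet : IsUnit (hess B x).det
  · refine hB.add_mem_interior hx ?_
    rw [iteratedDeriv_two_line (hB.contDiffAt_two hx)]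
    simp only
    rwa [mulVec_mulVec, mul_nonsing_inv _ hdet, one_mulVec, dotProduct_comm]
  · simpa [nonsing_inv_apply_not_isUnit _ hdet] using hx

theorem IsLHSCBarrier.posSemidef_of_mem_limitingInvHess (hB : IsLHSCBarrier K B ϑ) {x : Euc n}
    {M : Matrix (Fin n) (Fin n) ℝ} (hM : M ∈ limitingInvHess K B x) : M.PosSemidef := by
  obtain ⟨u, hu, -, hlim⟩ := hM
  have hps : ∀ k, (hess B (u k))⁻¹.PosSemidef := fun k => (hB.hess_posSemidef (hu k)).inv
  refine .of_dotProduct_mulVec_nonneg ?_ fun d => ?_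
  · refine tendsto_nhds_unique ((continuous_id.matrix_conjTranspose.tendsto M).comp hlim) ?_
    exact hlim.congr fun k => (hps k).1.symm
  · refine ge_of_tendsto' (((by fun_prop : Continuous fun A : Matrix (Fin n) (Fin n) ℝ =>
      star d ⬝ᵥ A *ᵥ d).tendsto M).comp hlim) fun k => (hps k).dotProduct_mulVec_nonneg d

/-- The limit of the Dikin ellipsoids: an ellipsoid around the possibly non-interior point `x`, with
shape matrix `M`, still lies in `K`. -/
theorem IsLHSCBarrier.add_mulVec_mem_of_mem_limitingInvHess (hB : IsLHSCBarrier K B ϑ)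
    (hK : IsClosed K) {x : Euc n} {M : Matrix (Fin n) (Fin n) ℝ}
    (hM : M ∈ limitingInvHess K B x) {w : Fin n → ℝ} (hw : w ⬝ᵥ M *ᵥ w < 1) :
    x + toLp 2 (M *ᵥ w) ∈ K := by
  obtain ⟨u, hu, hux, hlim⟩ := hM
  have h1 := (((by fun_prop : Continuous fun A : Matrix (Fin n) (Fin n) ℝ =>
      w ⬝ᵥ A *ᵥ w).tendsto M).comp hlim).eventually_lt_const hw
  have h2 := hux.add (((by fun_prop : Continuous fun A : Matrix (Fin n) (Fin n) ℝ =>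
      (toLp 2 (A *ᵥ w) : Euc n)).tendsto M).comp hlim)
  refine hK.mem_of_tendsto h2 ?_
  filter_upwards [h1] with k hk
  exact interior_subset (hB.add_inv_hess_mulVec_mem (hu k) hk)

end Barrier

/-! ### Lagrange multipliers -/

section Multiplier

variable {E F : Type*} [NormedAddCommGroup E] [NormedSpace ℝ E]
  [NormedAddCommGroup F] [NormedSpace ℝ F] [CompleteSpace F]

/-- Necessary conditions of first and second order in operator form. The hypothesis on `T` says that
the image under `T` of a neighborhood of `0`, translated to `x`, stays in `K`; by `hR`, the equality
constraint can be corrected within the range of `T`. -/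
theorem exists_multiplier (K : ConvexCone ℝ E) {f : E → ℝ} {c : E → F} {x : E} (hcx : c x = 0)
    (hf : ContDiffAt ℝ 2 f x) (hc : ContDiffAt ℝ 2 c x) (hc' : HasStrictFDerivAt c (fderiv ℝ c x) x)
    (hmin : IsLocalMinOn f {y | c y = 0 ∧ y ∈ (K : Set E)} x) {T : E →L[ℝ] E} {R : F →L[ℝ] E}
    (hT : ∀ᶠ w in 𝓝 (0 : E), x + T w ∈ K)
    (hR : fderiv ℝ c x ∘L (T ∘L R) = ContinuousLinearMap.id ℝ F) :
    ∃ l : F →L[ℝ] ℝ, (∀ y ∈ K, 0 ≤ fderiv ℝ f x y + l (fderiv ℝ c x y)) ∧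
      (∀ e, fderiv ℝ f x (T e) + l (fderiv ℝ c x (T e)) = 0) ∧
      ∀ e, fderiv ℝ c x (T e) = 0 →
        0 ≤ fderiv ℝ (fderiv ℝ fun y => f y + l (c y)) x (T e) (T e) := by
  have hfd := (hf.differentiableAt (by norm_num)).hasFDerivAt
  set f' := fderiv ℝ f x with hf'
  set c' := fderiv ℝ c x with hc'_def
  -- The multiplier is forced by stationarity on the range of `T ∘L R`, a complement
  -- of the kernel of `c'`.
  set l : F →L[ℝ] ℝ := -(f' ∘L (T ∘L R)) with hl
  have hTe : ∀ e, ∀ᶠ p : ℝ × F in 𝓝 0, 0 ≤ p.1 → x + (p.1 • T e + (T ∘L R) p.2) ∈ (K : Set E) := by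
    intro e
    have hcont : Tendsto (fun p : ℝ × F => p.1 • e + R p.2) (𝓝 0) (𝓝 0) := by
      simpa using (by fun_prop : Continuous fun p : ℝ × F => p.1 • e + R p.2).tendsto 0
    filter_upwards [hcont.eventually hT] with p hp _
    simpa using hp
  have hKy : ∀ y ∈ K, ∀ᶠ p : ℝ × F in 𝓝 0,
      0 ≤ p.1 → x + (p.1 • y + (T ∘L R) p.2) ∈ (K : Set E) := by
    intro y hy
    have hcont : Tendsto (fun p : ℝ × F => R p.2) (𝓝 0) (𝓝 0) := by
      simpa using (by fun_prop : Continuous fun p : ℝ × F => R p.2).tendsto 0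
    filter_upwards [hcont.eventually hT] with p hp hp0
    -- `K` is closed under addition, so `p.1 • y ∈ K` may be added to `x + T (R p.2) ∈ K`.
    rcases hp0.eq_or_lt with h0 | h0
    · simpa [← h0] using hp
    · rw [add_left_comm]
      exact K.add_mem (K.smul_mem h0 hy) hp
  have hfirst : ∀ v, (∀ᶠ p : ℝ × F in 𝓝 0,
      0 ≤ p.1 → x + (p.1 • v + (T ∘L R) p.2) ∈ (K : Set E)) → 0 ≤ f' v + l (c' v) := fun v hv => by
    have := nonneg_of_feasible_direction hcx hfd hc' hmin hR hv
    simpa [hl, sub_eq_add_neg] using this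
  have hstat : ∀ e, f' (T e) + l (c' (T e)) = 0 := fun e => by
    refine le_antisymm ?_ (hfirst _ (hTe e))
    have := hfirst _ (hTe (-e))
    simp only [map_neg] at this
    linarith
  refine ⟨l, fun y hy => hfirst y (hKy y hy), hstat, fun e he => ?_⟩
  obtain ⟨z, hz0, hz, hfz⟩ := exists_feasible_curve hcx hc' hmin hR (hTe e)
  have hL : ContDiffAt ℝ 2 (fun y => f y + l (c y)) x :=
    hf.add (l.contDiff.contDiffAt.comp x hc)
  have hLd : fderiv ℝ (fun y => f y + l (c y)) x = f' + l ∘L c' :=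
    (hfd.add (l.hasFDerivAt.comp x hc'.hasFDerivAt)).fderiv
  refine second_fderiv_nonneg_of_curve hL (h := fun t => t • T e + (T ∘L R) (z t)) (by simp [hz0])
    ?_ (fun t => ?_) ?_
  · convert! ((hasDerivAt_id (0 : ℝ)).smul_const (T e)).add
      ((T ∘L R).hasFDerivAt.comp_hasDerivAt 0 hz) using 1
    simp [he]
  · have := hstat (t • e + R (z t))
    rw [hLd]
    simpa using this
  · filter_upwards [hfz] with t ht
    rw [ht.1, hcx]
    simpa using ht.2

end Multiplier

/-! ### Ranges of square roots -/

section SquareRoot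

variable {n m : ℕ}

/-- A real symmetric matrix `A` has the same range as `A * A`; with `A` a square root of `M`, the
directions `M^{1/2} d` are the directions `M e`. -/
theorem exists_mulVec_eq_mul_self_mulVec {A : Matrix (Fin n) (Fin n) ℝ} (hA : Aᵀ = A)
    (d : Fin n → ℝ) : ∃ e, A *ᵥ d = (A * A) *ᵥ e := by
  have hle : LinearMap.range (A * A).mulVecLin ≤ LinearMap.range A.mulVecLin := by
    rw [mulVecLin_mul]; exact LinearMap.range_comp_le_range _ _
  have hrk : (A * A).rank = A.rank := by
    simpa [hA] using rank_transpose_mul_self A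
  have heq := Submodule.eq_of_le_of_finrank_eq hle hrk
  have hmem : A *ᵥ d ∈ LinearMap.range (A * A).mulVecLin := heq ▸ ⟨d, rfl⟩
  obtain ⟨e, he⟩ := hmem
  exact ⟨e, he.symm⟩

theorem isUnit_transpose_mul_self_of_rank_eq {A : Matrix (Fin n) (Fin m) ℝ} (hA : A.rank = m) :
    IsUnit (Aᵀ * A) := by
  rw [← mulVec_surjective_iff_isUnit]
  have hrk : (Aᵀ * A).rank = m := (rank_transpose_mul_self A).trans hA
  have htop : LinearMap.range (Aᵀ * A).mulVecLin = ⊤ :=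
    Submodule.eq_top_of_finrank_eq (by simpa [Matrix.rank] using hrk)
  exact LinearMap.range_eq_top.1 htop

end SquareRoot

end ConicOpt

open ConicOpt in
theorem theorem1 {n m : ℕ}
    (K : ProperCone ℝ (Euc n))
    (hK_pointed : ∀ x ∈ K, -x ∈ K → x = 0)
    (hK_int : (interior (K : Set (Euc n))).Nonempty)
    (B : Euc n → ℝ) (ϑ : ℝ) (hB : IsLHSCBarrier (K : Set (Euc n)) B ϑ)
    (f : Euc n → ℝ) (c : Euc n → Euc m) (xs : Euc n)
    (hxs : xs ∈ feasible (K : Set (Euc n)) c)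
    (hmin : IsLocalMinOn f (feasible (K : Set (Euc n)) c) xs)
    (hf : ContDiffAt ℝ 2 f xs) (hc : ContDiffAt ℝ 2 c xs)
    (M : Matrix (Fin n) (Fin n) ℝ)
    (hM : M ∈ limitingInvHess (K : Set (Euc n)) B xs)
    (hrank : (psdSqrt M * gradMat c xs).rank = m) :
    ∃ lam : Euc m,
      lagGrad f c xs lam ∈ ProperCone.innerDual (K : Set (Euc n)) ∧
      (psdSqrt M).mulVec (lagGrad f c xs lam).ofLp = 0 ∧
      ∀ d : Fin n → ℝ, ((gradMat c xs).transpose * psdSqrt M).mulVec d = 0 →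
        0 ≤ d ⬝ᵥ (psdSqrt M * lagHess f c xs lam * psdSqrt M).mulVec d := by
  open Matrix WithLp in
  have hcd : DifferentiableAt ℝ c xs := hc.differentiableAt (by norm_num)
  obtain ⟨hApsd, hAA⟩ := psdSqrt_spec (hB.posSemidef_of_mem_limitingInvHess hM)
  set A := psdSqrt M
  set G := gradMat c xs
  have hAt : Aᵀ = A := by simpa using hApsd.1.eq
  let T : Euc n →L[ℝ] Euc n := Matrix.toEuclideanCLM (𝕜 := ℝ) M
  have hTapp : ∀ e : Euc n, T e = toLp 2 (M *ᵥ e.ofLp) := fun e => rfl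
  have hT : ∀ᶠ w in 𝓝 (0 : Euc n), xs + T w ∈ (K : ConvexCone ℝ (Euc n)) := by
    have hlim : Tendsto (fun w : Euc n => w.ofLp ⬝ᵥ M *ᵥ w.ofLp) (𝓝 0) (𝓝 0) := by
      simpa using (by fun_prop : Continuous fun w : Euc n => w.ofLp ⬝ᵥ M *ᵥ w.ofLp).tendsto 0
    filter_upwards [hlim.eventually_lt_const one_pos] with w hw
    exact hB.add_mulVec_mem_of_mem_limitingInvHess K.isClosed hM hw
  have hN : IsUnit (Gᵀ * M * G) := by
    have := isUnit_transpose_mul_self_of_rank_eq hrank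
    rwa [transpose_mul, hAt, Matrix.mul_assoc, ← Matrix.mul_assoc A, hAA, ← Matrix.mul_assoc]
      at this
  -- `M G (Gᵀ M G)⁻¹` is a right inverse of the Jacobian `Gᵀ` of `c` with range in the range of `M`.
  let R : Euc m →L[ℝ] Euc n :=
    LinearMap.toContinuousLinearMap (Matrix.toEuclideanLin (G * (Gᵀ * M * G)⁻¹))
  have hRapp : ∀ z : Euc m, R z = toLp 2 ((G * (Gᵀ * M * G)⁻¹) *ᵥ z.ofLp) := fun z => rfl
  have hR : fderiv ℝ c xs ∘L (T ∘L R) = ContinuousLinearMap.id ℝ (Euc m) := by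
    ext1 z
    apply ofLp_injective 2
    change (fderiv ℝ c xs (T (R z))).ofLp = z.ofLp
    rw [← gradMat_transpose_mulVec hcd, hTapp, hRapp]
    simp only [mulVec_mulVec]
    rw [← Matrix.mul_assoc, ← Matrix.mul_assoc,
      Matrix.mul_nonsing_inv _ ((Matrix.isUnit_iff_isUnit_det _).1 hN), one_mulVec]
  obtain ⟨l, hdual, hstat, hsecond⟩ := exists_multiplier (K : ConvexCone ℝ (Euc n)) hxs.1 hf hc
    (hc.hasStrictFDerivAt (by norm_num)) hmin hT hR
  obtain ⟨lam, rfl⟩ := (InnerProductSpace.toDual ℝ (Euc m)).surjective l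
  simp only [InnerProductSpace.toDual_apply_apply] at hdual hstat hsecond
  refine ⟨lam, ?_, ?_, fun d hd => ?_⟩
  · rw [ProperCone.mem_innerDual]
    intro y hy
    rw [real_inner_comm, inner_lagGrad lam hcd]
    exact hdual y hy
  · -- Stationarity in the direction `M g`, with `g` the gradient of the Lagrangian, reads
    -- `gᵀ M g = ‖M^{1/2} g‖² = 0`.
    have h1 := hstat (lagGrad f c xs lam)
    rw [← inner_lagGrad lam hcd, hTapp, ← hAA, ← mulVec_mulVec,
      EuclideanSpace.inner_eq_star_dotProduct, star_trivial, dotProduct_comm, dotProduct_mulVec,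
      ← mulVec_transpose, hAt] at h1
    exact dotProduct_self_eq_zero.1 h1
  · obtain ⟨e, he⟩ := exists_mulVec_eq_mul_self_mulVec hAt d
    rw [hAA] at he
    have h1 : fderiv ℝ c xs (T (toLp 2 e)) = 0 := by
      apply ofLp_injective 2
      rw [← gradMat_transpose_mulVec hcd, hTapp]
      simpa [← he] using hd
    have h2 := hsecond _ h1
    rw [hTapp, ← dotProduct_hess_mulVec, hess_lagrangian lam hf hc] at h2
    simp only [← he] at h2
    rwa [← mulVec_mulVec, ← mulVec_mulVec, dotProduct_mulVec d, ← mulVec_transpose, hAt]
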